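/- Let $E$ be a separable real Banach space with dual $E'$, and let $(X_n)_{n\in\mathbb N}$ be $E$-valued Gaussian random variables (each possibly on its own probability space), not necessarily centered, that converge in law to an $E$-valued random variable $X$. Then $X$ is Gaussian. Let $\mu$ be the law of $X-\mathbb E[X]$ and let $\overline{E}'_\mu$ be the closure of $E'$ in $L^2(\mu)$. For $\phi\in\overline{E}'_\mu$ let $h_\phi=\int_E z\,\phi(z)\,d\mu(z)\in E$ be its barycenter (the map $\phi\mapsto h_\phi$ is injective on $\overline{E}'_\mu$). Let $\mathcal H=\{h_\phi:\phi\in\overline{E}'_\mu\}$ be the reproducing kernel Hilbert space of $\mu$, with norm $\|h_\phi\|_{\mathcal H}=\|\phi\|_{L^2(\mu)}$, and put $\|x\|_{\mathcal H}=+\infty$ for $x\in E\setminus\mathcal H$. Define $$I(x)=\tfrac12\|x\|_{\mathcal H}^2\in[0,+\infty],\qquad x\in E.$$ Then for every speed function $g$, i.e. every sequence $g=(g_n)_n$ of strictly positive real numbers with $g_n\to+\infty$, the sequence $(g_n^{-1/2}X_n)_n$ satisfies a Large Deviation Principle at speed $g$ with rate function $I$. That is, $I$ is lower semicontinuous on $E$;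 for every closed set $F\subset E$, $$\limsup_{n\to\infty}\frac1{g_n}\log\mathbb P\bigl(g_n^{-1/2}X_n\in F\bigr)\le-\inf_{x\in F}I(x);$$ and for every open set $G\subset E$, $$\liminf_{n\to\infty}\frac1{g_n}\log\mathbb P\bigl(g_n^{-1/2}X_n\in G\bigr)\ge-\inf_{x\in G}I(x),$$ with the conventions $\log 0=-\infty$ and $\inf\emptyset=+\infty$. -/

import Mathlib

open MeasureTheory ProbabilityTheory Filter Topology
open scoped ENNReal

noncomputable section

namespace GaussianLDP

variable {E : Type*} [NormedAddCommGroup E] [NormedSpace ℝ E] [MeasurableSpace E]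

/-- The closure in `L²(μ)` of the space of continuous linear functionals on `E`
(all of them are in `L²(μ)` as soon as `μ` has a finite second moment, for instance if `μ` is
Gaussian). -/
def dualClosure [OpensMeasurableSpace E] (μ : Measure E) : Submodule ℝ (Lp ℝ 2 μ) :=
  (LinearMap.range (StrongDual.toLp (𝕜 := ℝ) μ 2).toLinearMap).topologicalClosure

/-- The barycenter `∫ z φ(z) dμ(z)` of `φ ∈ L²(μ)`. -/
def barycenter (μ : Measure E) (φ : Lp ℝ 2 μ) : E := ∫ z, φ z • z ∂μ

/-- The elements of the reproducing kernel Hilbert space of `μ` (meant for `μ` centered Gaussian):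
the barycenters of the elements of the `L²(μ)`-closure of the dual. -/
def rkhs [OpensMeasurableSpace E] (μ : Measure E) : Set E := barycenter μ '' (dualClosure μ : Set _)

/-- The norm of the reproducing kernel Hilbert space of `μ`: the `L²(μ)` norm of `φ` at the
barycenter of `φ ∈ dualClosure μ`, and `∞` off the space (an infimum over the empty set).
The `φ` of a given barycenter is unique, see `rkhsNorm_barycenter`. -/
def rkhsNorm [OpensMeasurableSpace E] (μ : Measure E) (x : E) : ℝ≥0∞ :=
  ⨅ φ ∈ {φ : Lp ℝ 2 μ | φ ∈ dualClosure μ ∧ barycenter μ φ = x}, ‖φ‖ₑ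

theorem rkhsNorm_of_notMem [OpensMeasurableSpace E] {μ : Measure E} {x : E} (hx : x ∉ rkhs μ) : rkhsNorm μ x = ∞ := by
  refine iInf₂_eq_top.2 fun φ hφ ↦ (hx ⟨φ, hφ.1, hφ.2⟩).elim

/-- The Large Deviation Principle at speed `g` with rate function `I` for a sequence of measures
(the laws of a sequence of random variables). -/
structure SatisfiesLDP (μ : ℕ → Measure E) (g : ℕ → ℝ) (I : E → ℝ≥0∞) : Prop where
  /-- The rate function is lower semicontinuous. -/
  lowerSemicontinuous : LowerSemicontinuous I
  /-- The upper bound for closed sets. -/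
  upper : ∀ F : Set E, IsClosed F →
    limsup (fun n ↦ (((g n)⁻¹ : ℝ) : EReal) * ENNReal.log (μ n F)) atTop
      ≤ -((⨅ x ∈ F, I x : ℝ≥0∞) : EReal)
  /-- The lower bound for open sets. -/
  lower : ∀ G : Set E, IsOpen G →
    -((⨅ x ∈ G, I x : ℝ≥0∞) : EReal)
      ≤ liminf (fun n ↦ (((g n)⁻¹ : ℝ) : EReal) * ENNReal.log (μ n G)) atTop

section WellDefined

variable [BorelSpace E] [SecondCountableTopology E] [CompleteSpace E] {μ : Measure E}

theorem inner_toLp_eq (h : MemLp id 2 μ) (L : StrongDual ℝ E) (φ : Lp ℝ 2 μ) :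
    inner ℝ (StrongDual.toLp (𝕜 := ℝ) μ 2 L) φ = L (barycenter μ φ) := by
  have hint : Integrable (fun z ↦ φ z • z) μ := by
    have h1 : MemLp (fun z ↦ φ z • id z) 1 μ := h.smul (Lp.memLp φ)
    exact memLp_one_iff_integrable.1 h1
  rw [L2.inner_def, barycenter, ← L.integral_comp_comm hint]
  rw [StrongDual.toLp_apply h]
  refine integral_congr_ae ?_
  have hL : MemLp L 2 μ := h.continuousLinearMap_comp L
  filter_upwards [hL.coeFn_toLp] with z hz
  rw [hz]
  simp [mul_comm]

theorem barycenter_injOn (h : MemLp id 2 μ) :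
    Set.InjOn (barycenter μ) (dualClosure μ : Set (Lp ℝ 2 μ)) := by
  intro φ hφ ψ hψ heq
  have hmem : φ - ψ ∈ dualClosure μ := Submodule.sub_mem _ hφ hψ
  have horth : φ - ψ ∈ (dualClosure μ)ᗮ := by
    rw [dualClosure, Submodule.orthogonal_closure, Submodule.mem_orthogonal]
    rintro _ ⟨L, rfl⟩
    have := inner_toLp_eq h L φ
    have := inner_toLp_eq h L ψ
    simp_all [inner_sub_right]
  have := Submodule.inner_right_of_mem_orthogonal hmem horth
  exact sub_eq_zero.1 (inner_self_eq_zero.1 this)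

/-- The norm is well defined, and `φ ↦ barycenter μ φ` is an isometry. -/
theorem rkhsNorm_barycenter [IsGaussian μ] {φ : Lp ℝ 2 μ} (hφ : φ ∈ dualClosure μ) :
    rkhsNorm μ (barycenter μ φ) = ‖φ‖ₑ := by
  refine le_antisymm (iInf₂_le φ ⟨hφ, rfl⟩) (le_iInf₂ fun ψ hψ ↦ ?_)
  rw [barycenter_injOn IsGaussian.memLp_two_id hψ.1 hφ hψ.2]

end WellDefined

end GaussianLDP

end

/-! The rate function is the Legendre transform of the log-Laplace functional `L ↦ ‖L‖² / 2` (norm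
in `L²(μ)`), so finiteness of `I x` says that evaluation at `x` is `L²`-bounded; Hahn–Banach and
Riesz then put `x` in the reproducing kernel space. Lower semicontinuity is immediate.

Upper bound: exponential Chebyshev controls half-spaces, finitely many of which cover a compact set.
Exponential tightness extends this to closed sets: a sequence converging in law is tight, and
Fernique's inequality for one absolutely convex compact set bounds the tails of all `ν n` at once.

Lower bound: barycenters of continuous functionals are dense enough to test `I` on open sets.
Cameron–Martin and symmetry bound from below the mass of a ball moved to such a point; that point
must be `covOp (ν n) L`, so `tendsto_covOp` supplies norm convergence to `covOp ν' L`.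

Means stay in a compact set, hence vanish after division by `√(g n)`; with convergence of variances
this also makes the limit Gaussian. -/

namespace GaussianLDP

/-! ### Cameron–Martin shifts of a centered Gaussian measure -/

section Centered

variable {E : Type*} [NormedAddCommGroup E] [NormedSpace ℝ E] [CompleteSpace E]
  [SecondCountableTopology E] [MeasurableSpace E] [BorelSpace E] {μ : Measure E} [IsGaussian μ]

/-- The barycenter of a continuous linear functional: the covariance operator of `μ`. -/
noncomputable def covOp (μ : Measure E) (L : StrongDual ℝ E) : E :=
  barycenter μ (L.toLp μ 2)

lemma apply_covOp (L M : StrongDual ℝ E) :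
    M (covOp μ L) = inner ℝ (M.toLp μ 2) (L.toLp μ 2) :=
  (inner_toLp_eq IsGaussian.memLp_two_id M _).symm

omit [CompleteSpace E] [SecondCountableTopology E] [IsGaussian μ] in
lemma covOp_smul (c : ℝ) (L : StrongDual ℝ E) : covOp μ (c • L) = c • covOp μ L := by
  unfold covOp barycenter
  rw [map_smul, ← integral_smul]
  refine integral_congr_ae ?_
  filter_upwards [Lp.coeFn_smul c (L.toLp μ 2)] with z hz
  rw [hz, Pi.smul_apply, smul_eq_mul, mul_smul]

lemma integral_dual_eq_zero (h0 : μ[id] = 0) (L : StrongDual ℝ E) : μ[L] = 0 := by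
  simp only [id_eq] at h0
  simp [IsGaussian.integral_dual, h0]

lemma variance_eq_sq_norm_toLp (h0 : μ[id] = 0) (L : StrongDual ℝ E) :
    Var[L; μ] = ‖L.toLp μ 2‖ ^ 2 := by
  rw [variance_of_integral_eq_zero (by fun_prop) (integral_dual_eq_zero h0 L),
    ← real_inner_self_eq_norm_sq, L2.inner_def, StrongDual.toLp_apply IsGaussian.memLp_two_id]
  refine integral_congr_ae ?_
  filter_upwards [(IsGaussian.memLp_dual μ L 2 (by simp)).coeFn_toLp] with z hz
  simp only [hz]
  simp [pow_two]

omit [CompleteSpace E] [SecondCountableTopology E] in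
lemma integrable_exp_dual (L : StrongDual ℝ E) : Integrable (fun x ↦ Real.exp (L x)) μ := by
  have h := integrable_exp_mul_gaussianReal (μ := μ[L]) (v := Var[L; μ].toNNReal) 1
  rw [← IsGaussian.map_eq_gaussianReal L, integrable_map_measure (by fun_prop) (by fun_prop)] at h
  simpa [Function.comp_def] using h

lemma integral_exp_dual (h0 : μ[id] = 0) (L : StrongDual ℝ E) :
    ∫ x, Real.exp (L x) ∂μ = Real.exp (‖L.toLp μ 2‖ ^ 2 / 2) := by
  have h := mgf_gaussianReal (IsGaussian.map_eq_gaussianReal (μ := μ) L) 1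
  rw [integral_dual_eq_zero h0 L] at h
  simpa [mgf, variance_nonneg, variance_eq_sq_norm_toLp h0 L] using h

lemma map_neg_eq_self (h0 : μ[id] = 0) : μ.map (fun x ↦ -x) = μ := by
  have : IsProbabilityMeasure (μ.map (fun x ↦ -x)) :=
    Measure.isProbabilityMeasure_map (by fun_prop)
  refine Measure.ext_of_charFunDual ?_
  ext L
  have h1 : charFunDual (μ.map (fun x ↦ -x)) L = charFunDual μ (-L) := by
    rw [charFunDual_apply, charFunDual_apply, integral_map (by fun_prop) (by fun_prop)]
    simp
  rw [h1, IsGaussian.charFunDual_eq_of_integral_eq_zero h0,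
    IsGaussian.charFunDual_eq_of_integral_eq_zero h0, variance_eq_sq_norm_toLp h0,
    variance_eq_sq_norm_toLp h0, map_neg, norm_neg]

/-- The **Cameron–Martin formula** for the barycenters of continuous linear functionals. -/
theorem map_add_covOp (h0 : μ[id] = 0) (L : StrongDual ℝ E) :
    μ.map (fun x ↦ x + covOp μ L) = μ.tilted L := by
  have hp1 : IsProbabilityMeasure (μ.map (fun x ↦ x + covOp μ L)) :=
    Measure.isProbabilityMeasure_map (by fun_prop)
  have hp2 : IsProbabilityMeasure (μ.tilted L) :=
    isProbabilityMeasure_tilted (integrable_exp_dual L)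
  refine Measure.ext_of_charFunDual ?_
  ext M
  rw [charFunDual_eq_charFun_map_one, charFunDual_eq_charFun_map_one]
  congr 1
  -- Real moment generating functions suffice: they are finite everywhere, so by analytic
  -- continuation they determine the complex ones on the whole plane.
  refine Measure.ext_of_complexMGF_eq (by fun_prop) (by fun_prop) ?_
  have hmgf : mgf M (μ.map (fun x ↦ x + covOp μ L)) = mgf M (μ.tilted L) := by
    ext t
    simp only [mgf]
    rw [integral_map (by fun_prop) (by fun_prop), integral_exp_tilted]
    have h1 : ∀ x, Real.exp (t * M (x + covOp μ L))
        = Real.exp (t * M (covOp μ L)) * Real.exp ((t • M) x) := fun x ↦ by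
      rw [← Real.exp_add]; congr 1; simp; ring
    have h2 : ∀ x, (⇑L + fun x ↦ t * M x) x = (L + t • M) x := fun x ↦ by simp
    simp_rw [h1, h2]
    rw [integral_const_mul, integral_exp_dual h0, integral_exp_dual h0, integral_exp_dual h0,
      ← Real.exp_add, ← Real.exp_sub, apply_covOp]
    congr 1
    rw [map_add, map_smul, norm_add_sq_real, inner_smul_right, real_inner_comm]
    ring
  have huniv : integrableExpSet M (μ.tilted L) = Set.univ := by
    refine Set.eq_univ_of_forall fun t ↦ ?_
    change Integrable _ _
    rw [integrable_tilted_iff (integrable_exp_dual L)]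
    refine (integrable_exp_dual (L + t • M)).congr (.of_forall fun x ↦ ?_)
    simp [Real.exp_add]
  ext z
  refine (eqOn_complexMGF_of_mgf hmgf.symm ?_).symm
  simp [huniv]

/-- Shifting a symmetric set by the barycenter of `L` decreases its Gaussian measure at most by the
factor `exp (-‖L‖² / 2)`. -/
theorem exp_mul_measure_le_measure_add_covOp (h0 : μ[id] = 0) (L : StrongDual ℝ E) {B : Set E}
    (hB : MeasurableSet B) (hsymm : ∀ x, -x ∈ B ↔ x ∈ B) :
    ENNReal.ofReal (Real.exp (-(‖L.toLp μ 2‖ ^ 2 / 2))) * μ B ≤ μ {x | x + covOp μ L ∈ B} := by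
  set c := Real.exp (‖L.toLp μ 2‖ ^ 2 / 2) with hc
  have hc0 : 0 < c := Real.exp_pos _
  have h1 : μ {x | x + covOp μ L ∈ B} = ∫⁻ x in B, ENNReal.ofReal (Real.exp (L x) / c) ∂μ := by
    have : μ {x | x + covOp μ L ∈ B} = μ.map (fun x ↦ x + covOp μ L) B :=
      (Measure.map_apply (by fun_prop) hB).symm
    rw [this, map_add_covOp h0, tilted_apply, integral_exp_dual h0]
  -- Symmetry of `μ` and `B` allows `L` to be replaced by `-L`; averaging the two densities gives
  -- `cosh (L x) / c ≥ 1 / c`.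
  have h2 : ∫⁻ x in B, ENNReal.ofReal (Real.exp (L x) / c) ∂μ
      = ∫⁻ x in B, ENNReal.ofReal (Real.exp (-L x) / c) ∂μ := by
    conv_lhs => rw [← map_neg_eq_self h0]
    rw [setLIntegral_map hB (by fun_prop) (by fun_prop)]
    have : (fun x : E ↦ -x) ⁻¹' B = B := by ext x; exact hsymm x
    simp [this]
  have h3 : 2 * (ENNReal.ofReal c⁻¹ * μ B)
      ≤ 2 * ∫⁻ x in B, ENNReal.ofReal (Real.exp (L x) / c) ∂μ := by
    rw [two_mul (∫⁻ x in B, _ ∂μ)]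
    nth_rw 2 [h2]
    rw [← lintegral_add_left (by fun_prop), ← mul_assoc, ← setLIntegral_const]
    refine lintegral_mono fun x ↦ ?_
    rw [← ENNReal.ofReal_add (by positivity) (by positivity),
      show (2 : ℝ≥0∞) = ENNReal.ofReal 2 by simp, ← ENNReal.ofReal_mul (by simp)]
    refine ENNReal.ofReal_le_ofReal ?_
    rw [← add_div, div_eq_mul_inv]
    gcongr
    have := Real.one_le_cosh (L x)
    rw [Real.cosh_eq] at this
    linarith
  rw [Real.exp_neg, ← hc, h1]
  exact (ENNReal.mul_le_mul_iff_right (by simp) (by simp)).1 h3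

end Centered

/-! ### Fernique's inequality for the gauge of a convex set -/

section Fernique

variable {E : Type*} [NormedAddCommGroup E] [NormedSpace ℝ E] [CompleteSpace E]
  [SecondCountableTopology E] [MeasurableSpace E] [BorelSpace E] {μ : Measure E}

open scoped Pointwise

-- Put `u = (x - y) / √2` and `v = (x + y) / √2`, again independent with law `μ`. As `√2 x = v + u`
-- and `√2 y = v - u`, having `u ∈ a • K` and `v ∉ b • K` forces both `x` and `y` out of `c • K`.
omit [CompleteSpace E] in
lemma measure_smul_mul_measure_compl_smul_le [SFinite μ]
    (h : (μ.prod μ).map (ContinuousLinearMap.rotation (-(Real.pi / 4))) = μ.prod μ)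
    {K : Set E} (hK : AbsConvex ℝ K) (hc : IsClosed K) {a b c : ℝ} (ha : 0 < a) (hb : 0 < b)
    (hc0 : 0 < c) (habc : a + √2 * c ≤ b) :
    μ (a • K) * μ (b • K)ᶜ ≤ μ (c • K)ᶜ ^ 2 := by
  have hm : ∀ {r : ℝ}, 0 < r → MeasurableSet (r • K) := fun hr ↦
    (hc.smul_of_ne_zero hr.ne').measurableSet
  have hsum : a • K + (√2 * c) • K ⊆ b • K := by
    rw [← hK.2.add_smul ha.le (by positivity)]
    refine hK.1.smul_mono ?_
    rw [Real.norm_of_nonneg (by positivity), Real.norm_of_nonneg hb.le]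
    exact habc
  have hneg : ∀ {x}, x ∈ a • K → -x ∈ a • K := by
    rintro _ ⟨y, hy, rfl⟩
    exact ⟨-y, (hK.1.neg_mem_iff).2 hy, by simp⟩
  rw [← Measure.prod_prod, pow_two, ← Measure.prod_prod, ← h,
    Measure.map_apply (by fun_prop) ((hm ha).prod (hm hb).compl), h]
  refine measure_mono ?_
  rintro ⟨x, y⟩ ⟨h1, h2⟩
  simp only [ContinuousLinearMap.rotation_apply, Real.cos_neg,
      Real.cos_pi_div_four, Real.sin_neg, Real.sin_pi_div_four, neg_smul, neg_neg] at h1 h2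
  have key : ∀ z ∈ c • K, √2 • z ∈ (√2 * c) • K := fun z hz ↦ by
    rw [mul_smul]; exact Set.smul_mem_smul_set hz
  refine ⟨fun hx ↦ h2 (hsum ⟨_, hneg h1, _, key x hx, ?_⟩),
    fun hy ↦ h2 (hsum ⟨_, h1, _, key y hy, ?_⟩)⟩
  · module
  · module

/-- Fernique's bound for a symmetric convex set of large probability. -/
theorem measure_compl_smul_le_exp [IsGaussian μ] (h0 : μ[id] = 0) {K : Set E}
    (hK : AbsConvex ℝ K) (hc : IsClosed K) (hμK : μ Kᶜ ≤ ENNReal.ofReal (1 / 4)) {T : ℝ}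
    (hT : 1 ≤ T) :
    μ ((4 * √(2 * T)) • K)ᶜ ≤ ENNReal.ofReal (Real.exp (-T)) := by
  have hrot := IsGaussian.map_rotation_eq_self h0 (-(Real.pi / 4))
  have hs2 : √2 * √2 = 2 := Real.mul_self_sqrt (by simp)
  have hs2' : 1 < √2 := Real.lt_sqrt_of_sq_lt (by norm_num)
  have hs2'' : √2 < 3 / 2 := by rw [Real.sqrt_lt' (by simp)]; norm_num
  -- Chosen so that `t 0 = 1` and `1 + √2 * t n ≤ t (n + 1)`, the latter because `3 * √2 ≥ 4`.
  set t : ℕ → ℝ := fun n ↦ 4 * √2 ^ n - 3 with ht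
  have ht1 : ∀ n, 1 ≤ t n := fun n ↦ by
    have := one_le_pow₀ hs2'.le (n := n)
    simp only [ht]; linarith
  have hKm : MeasurableSet K := hc.measurableSet
  have hK34 : 3 / 4 ≤ μ.real K := by
    have h1 : μ.real Kᶜ ≤ 1 / 4 := by
      rw [Measure.real]
      exact ENNReal.toReal_le_of_le_ofReal (by norm_num) hμK
    rw [probReal_compl_eq_one_sub hKm] at h1
    linarith
  have step : ∀ n, μ.real K * μ.real (t (n + 1) • K)ᶜ ≤ μ.real (t n • K)ᶜ ^ 2 := fun n ↦ by
    have := measure_smul_mul_measure_compl_smul_le hrot hK hc (a := 1) (b := t (n + 1))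
      (c := t n) one_pos (by linarith [ht1 (n + 1)]) (by linarith [ht1 n])
      (by simp only [ht, pow_succ]; nlinarith)
    rw [one_smul] at this
    have := ENNReal.toReal_mono (by finiteness) this
    simpa [Measure.real, ENNReal.toReal_mul] using this
  -- The tail divided by `μ K` is at most squared at each step, starting from `(1/4) / (3/4) = 1/3 ≤
  -- exp (-1)`.
  have hexp : ∀ n : ℕ, μ.real (t n • K)ᶜ ≤ μ.real K * Real.exp (-2 ^ n) := fun n ↦ by
    induction n with
    | zero =>
      have h1 : t 0 = 1 := by simp [ht]; norm_num
      rw [h1, one_smul, probReal_compl_eq_one_sub hKm, pow_zero]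
      have : 1 / 3 ≤ Real.exp (-1) := by
        rw [Real.exp_neg, one_div]
        exact inv_anti₀ (Real.exp_pos _) (Real.exp_one_lt_d9.le.trans (by norm_num))
      nlinarith
    | succ n ih =>
      have h1 : μ.real (t n • K)ᶜ ^ 2 ≤ (μ.real K * Real.exp (-2 ^ n)) ^ 2 := by gcongr
      have h2 : Real.exp (-2 ^ (n + 1)) = Real.exp (-2 ^ n) ^ 2 := by
        rw [← Real.exp_nat_mul]; congr 1; push_cast; ring
      have h3 := step n
      rw [h2]
      have hpos : 0 < μ.real K := by linarith
      refine le_of_mul_le_mul_left (h3.trans (h1.trans (le_of_eq ?_))) hpos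
      ring
  -- With `2 ^ n ≤ T < 2 ^ (n + 1)`, the radius `t (n + 1)` is below `4 * √(2 * T)` and the exponent
  -- is better than `-T`.
  obtain ⟨n, hn1, hn2⟩ := exists_nat_pow_near hT (one_lt_two)
  have hsub : ((4 * √(2 * T)) • K)ᶜ ⊆ (t (n + 1) • K)ᶜ := by
    rw [Set.compl_subset_compl]
    refine hK.1.smul_mono ?_
    rw [Real.norm_of_nonneg (by linarith [ht1 (n + 1)]), Real.norm_of_nonneg (by positivity)]
    have : √2 ^ (n + 1) ≤ √(2 * T) := by
      refine Real.le_sqrt_of_sq_le ?_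
      rw [← pow_mul, mul_comm, pow_mul, Real.sq_sqrt (by simp), pow_succ']
      linarith
    simp only [ht]
    linarith
  refine (measure_mono hsub).trans ?_
  rw [← ofReal_measureReal]
  refine ENNReal.ofReal_le_ofReal ((hexp _).trans ?_)
  have : Real.exp (-2 ^ (n + 1)) ≤ Real.exp (-T) := by gcongr
  have h1 : μ.real K ≤ 1 := measureReal_le_one
  nlinarith [Real.exp_pos (-T), Real.exp_pos (-2 ^ (n + 1)), measureReal_nonneg (μ := μ) (s := K)]

end Fernique

/-! ### The rate function as a Legendre transform -/

section RateFunction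

lemma ofReal_div_two (x : ℝ) : ENNReal.ofReal (x / 2) = ENNReal.ofReal x / 2 := by
  rw [ENNReal.ofReal_div_of_pos two_pos, ENNReal.ofReal_ofNat]

variable {E : Type*} [NormedAddCommGroup E] [NormedSpace ℝ E] [CompleteSpace E]
  [SecondCountableTopology E] [MeasurableSpace E] [BorelSpace E] {μ : Measure E}

lemma continuous_barycenter (h : MemLp id 2 μ) : Continuous (barycenter μ) := by
  refine (LipschitzWith.of_dist_le' (K := ‖StrongDual.toLp (𝕜 := ℝ) (E := E) μ 2‖)
    fun φ ψ ↦ ?_).continuous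
  rw [dist_eq_norm, dist_eq_norm]
  refine NormedSpace.norm_le_dual_bound ℝ _ (by positivity) fun L ↦ ?_
  rw [map_sub, ← inner_toLp_eq h, ← inner_toLp_eq h, ← inner_sub_right]
  refine (norm_inner_le_norm _ _).trans ?_
  have := (StrongDual.toLp (𝕜 := ℝ) (E := E) μ 2).le_opNorm L
  calc _ ≤ ‖StrongDual.toLp (𝕜 := ℝ) (E := E) μ 2‖ * ‖L‖ * ‖φ - ψ‖ := by gcongr
    _ = _ := by ring

lemma apply_sub_le_rkhsNorm_sq (h : MemLp id 2 μ) (x : E) (L : StrongDual ℝ E) :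
    ENNReal.ofReal (L x - ‖L.toLp μ 2‖ ^ 2 / 2) ≤ rkhsNorm μ x ^ 2 / 2 := by
  by_cases hx : x ∈ rkhs μ
  · obtain ⟨φ, hφ, rfl⟩ := hx
    have hnorm : rkhsNorm μ (barycenter μ φ) = ‖φ‖ₑ := by
      refine le_antisymm (iInf₂_le φ ⟨hφ, rfl⟩) (le_iInf₂ fun ψ hψ ↦ ?_)
      rw [barycenter_injOn h hψ.1 hφ hψ.2]
    rw [hnorm, ← ofReal_norm, ← ENNReal.ofReal_pow (norm_nonneg _), ← ofReal_div_two,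
      ← inner_toLp_eq h]
    refine ENNReal.ofReal_le_ofReal ?_
    have := real_inner_le_norm (L.toLp μ 2) φ
    nlinarith [sq_nonneg (‖L.toLp μ 2‖ - ‖φ‖)]
  · rw [rkhsNorm_of_notMem hx]
    simp [ENNReal.top_div]

/-- A point whose Legendre transform is finite lies in the reproducing kernel Hilbert space: the
evaluation at `x` is then bounded for the `L²` norm, and is represented by an element of
`dualClosure μ` with barycenter `x`. -/
lemma rkhsNorm_sq_le_of_forall_apply_sub_le (h : MemLp id 2 μ) {x : E} {S : ℝ} (hS : 0 ≤ S)
    (hx : ∀ L : StrongDual ℝ E, L x - ‖L.toLp μ 2‖ ^ 2 / 2 ≤ S) :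
    rkhsNorm μ x ^ 2 / 2 ≤ ENNReal.ofReal S := by
  set T := StrongDual.toLp (𝕜 := ℝ) (E := E) μ 2
  have hbound : ∀ L : StrongDual ℝ E, |L x| ≤ √(2 * S) * ‖T L‖ := fun L ↦ by
    -- The hypothesis at `s • L` is a quadratic inequality in `s`; its discriminant gives the bound.
    have h1 : ∀ s : ℝ, 0 ≤ ‖T L‖ ^ 2 / 2 * (s * s) + -L x * s + S := fun s ↦ by
      have := hx (s • L)
      rw [map_smul, norm_smul, mul_pow, Real.norm_eq_abs, sq_abs] at this
      simp only [smul_apply, smul_eq_mul] at this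
      linarith
    have h2 := discrim_le_zero h1
    rw [discrim] at h2
    refine abs_le_of_sq_le_sq ?_ (by positivity)
    rw [mul_pow, Real.sq_sqrt (by positivity)]
    linarith
  have : Module.Free ℝ (LinearMap.range T.toLinearMap) := Module.Free.of_divisionRing ℝ _
  -- `T` need not be injective. A linear section defines evaluation at `x` on its range, and
  -- `hbound` shows that the value does not depend on the section.
  obtain ⟨g, hg⟩ := LinearMap.exists_rightInverse_of_surjective T.toLinearMap.rangeRestrict
    (LinearMap.range_rangeRestrict _)
  have hTg : ∀ y, T (g y) = y := fun y ↦ congrArg Subtype.val (LinearMap.congr_fun hg y)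
  let f : LinearMap.range T.toLinearMap →ₗ[ℝ] ℝ :=
    { toFun := fun y ↦ g y x
      map_add' := by simp
      map_smul' := by simp }
  have hf : ∀ y, ‖f y‖ ≤ √(2 * S) * ‖y‖ := fun y ↦ by
    have := hbound (g y)
    rwa [hTg] at this
  obtain ⟨F, hF, hFn⟩ := _root_.exists_extension_norm_eq _ (f.mkContinuous _ hf)
  have hFT : ∀ L, F (T L) = L x := fun L ↦ by
    rw [hF ⟨T L, L, rfl⟩]
    change g ⟨T L, L, rfl⟩ x = L x
    have h1 := hbound (g ⟨T L, L, rfl⟩ - L)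
    rw [map_sub, hTg, sub_self, norm_zero, mul_zero] at h1
    have h2 := abs_nonpos_iff.1 h1
    simpa [sub_eq_zero] using h2
  have hFn' : ‖F‖ ≤ √(2 * S) := hFn.trans_le (LinearMap.mkContinuous_norm_le _ (by positivity) _)
  set φ₀ := (InnerProductSpace.toDual ℝ (Lp ℝ 2 μ)).symm F
  have hcl : IsClosed (dualClosure μ : Set (Lp ℝ 2 μ)) := Submodule.isClosed_topologicalClosure _
  have : CompleteSpace (dualClosure μ) := hcl.completeSpace_coe
  have hmem : ∀ L, T L ∈ dualClosure μ := fun L ↦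
    Submodule.le_topologicalClosure _ ⟨L, rfl⟩
  -- The Riesz representative may lie outside `dualClosure μ`; projecting it changes no pairing with
  -- `T L` and does not increase the norm.
  have hφx : barycenter μ ((dualClosure μ).starProjection φ₀) = x := by
    refine (SeparatingDual.eq_iff_forall_dual_eq (R := ℝ)).2 fun L ↦ ?_
    rw [← inner_toLp_eq h, ← Submodule.inner_starProjection_left_eq_right,
      Submodule.starProjection_eq_self_iff.2 (hmem L), real_inner_comm,
      InnerProductSpace.toDual_symm_apply, hFT]
  have hle : rkhsNorm μ x ≤ ENNReal.ofReal √(2 * S) := by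
    refine (iInf₂_le ((dualClosure μ).starProjection φ₀)
      ⟨Submodule.starProjection_apply_mem _ _, hφx⟩).trans ?_
    rw [← ofReal_norm]
    refine ENNReal.ofReal_le_ofReal (((dualClosure μ).norm_starProjection_apply_le _).trans ?_)
    simpa [φ₀] using hFn'
  calc rkhsNorm μ x ^ 2 / 2 ≤ ENNReal.ofReal √(2 * S) ^ 2 / 2 := by gcongr
    _ = ENNReal.ofReal S := by
      rw [← ENNReal.ofReal_pow (by positivity), Real.sq_sqrt (by positivity),
        ← ofReal_div_two]
      congr 1
      ring

/-- The rate function is the Legendre transform of the logarithmic Laplace transform. -/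
theorem rkhsNorm_sq_eq_iSup (h : MemLp id 2 μ) (x : E) :
    rkhsNorm μ x ^ 2 / 2
      = ⨆ L : StrongDual ℝ E, ENNReal.ofReal (L x - ‖L.toLp μ 2‖ ^ 2 / 2) := by
  refine le_antisymm ?_ (iSup_le (apply_sub_le_rkhsNorm_sq h x))
  set S := ⨆ L : StrongDual ℝ E, ENNReal.ofReal (L x - ‖L.toLp μ 2‖ ^ 2 / 2) with hS
  by_cases htop : S = ∞
  · simp [htop]
  rw [← ENNReal.ofReal_toReal htop]
  refine rkhsNorm_sq_le_of_forall_apply_sub_le h ENNReal.toReal_nonneg fun L ↦ ?_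
  rw [← ENNReal.ofReal_le_iff_le_toReal htop]
  exact le_iSup (fun L : StrongDual ℝ E ↦ ENNReal.ofReal (L x - ‖L.toLp μ 2‖ ^ 2 / 2)) L

theorem lowerSemicontinuous_rkhsNorm_sq (h : MemLp id 2 μ) :
    LowerSemicontinuous fun x ↦ rkhsNorm μ x ^ 2 / 2 := by
  simp_rw [rkhsNorm_sq_eq_iSup h]
  refine lowerSemicontinuous_iSup fun L ↦
    (ENNReal.continuous_ofReal.comp ?_).lowerSemicontinuous
  fun_prop

lemma exists_lt_apply_sub (h : MemLp id 2 μ) {x : E} {s : ℝ} (hs : 0 ≤ s)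
    (hx : ENNReal.ofReal s < rkhsNorm μ x ^ 2 / 2) :
    ∃ L : StrongDual ℝ E, s < L x - ‖L.toLp μ 2‖ ^ 2 / 2 := by
  by_contra! hcon
  exact hx.not_ge (rkhsNorm_sq_le_of_forall_apply_sub_le h hs hcon)

/-- Functionals are dense in `dualClosure μ`, and the barycenter and the norm are continuous, so a
near-optimal `φ` can be replaced by a functional. -/
lemma exists_covOp_mem (h : MemLp id 2 μ) {x : E} {s : ℝ}
    (hx : rkhsNorm μ x ^ 2 / 2 < ENNReal.ofReal s) {G : Set E} (hG : IsOpen G) (hxG : x ∈ G) :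
    ∃ L : StrongDual ℝ E, covOp μ L ∈ G ∧ ‖L.toLp μ 2‖ ^ 2 / 2 < s := by
  have hlt : ∃ φ ∈ dualClosure μ, barycenter μ φ = x ∧ ‖φ‖ ^ 2 / 2 < s := by
    by_contra! hcon
    refine hx.not_ge ?_
    have h1 : ENNReal.ofReal √(2 * s) ≤ rkhsNorm μ x := by
      refine le_iInf₂ fun φ hφ ↦ ?_
      rw [← ofReal_norm]
      refine ENNReal.ofReal_le_ofReal (Real.sqrt_le_iff.2 ⟨norm_nonneg _, ?_⟩)
      have := hcon φ hφ.1 hφ.2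
      linarith
    have hs : 0 ≤ s := by
      by_contra! hs
      simp [ENNReal.ofReal_of_nonpos hs.le] at hx
    calc ENNReal.ofReal s = ENNReal.ofReal √(2 * s) ^ 2 / 2 := by
          rw [← ENNReal.ofReal_pow (by positivity), Real.sq_sqrt (by positivity),
            ← ofReal_div_two]
          congr 1
          ring
      _ ≤ rkhsNorm μ x ^ 2 / 2 := by gcongr
  obtain ⟨φ, hφ, rfl, hφs⟩ := hlt
  have hopen : IsOpen {ψ : Lp ℝ 2 μ | barycenter μ ψ ∈ G ∧ ‖ψ‖ ^ 2 / 2 < s} :=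
    (hG.preimage (continuous_barycenter h)).inter
      (isOpen_lt ((continuous_norm.pow 2).div_const 2) continuous_const)
  obtain ⟨_, hψ, L, rfl⟩ := mem_closure_iff.1 hφ _ hopen ⟨hxG, hφs⟩
  exact ⟨L, hψ⟩

end RateFunction

/-! ### Separating the mean from the fluctuations -/

section Centering

variable {E : Type*} [NormedAddCommGroup E] [NormedSpace ℝ E] [CompleteSpace E]
  [SecondCountableTopology E] [MeasurableSpace E] [BorelSpace E]

/-- The translate of `μ` with mean zero. -/
noncomputable def centered (μ : Measure E) : Measure E := μ.map (fun x ↦ x - ∫ y, y ∂μ)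

instance (μ : Measure E) [IsGaussian μ] : IsGaussian (centered μ) := by
  unfold centered; infer_instance

lemma integral_id_centered (μ : Measure E) [IsGaussian μ] : (centered μ)[id] = 0 := by
  rw [centered, integral_map (by fun_prop) (by fun_prop)]
  have : Integrable (fun x ↦ x) μ := IsGaussian.integrable_id
  simp [integral_sub this (integrable_const _)]

lemma sq_norm_toLp_centered (μ : Measure E) [IsGaussian μ] (L : StrongDual ℝ E) :
    ‖L.toLp (centered μ) 2‖ ^ 2 = Var[L; μ] := by
  rw [← variance_eq_sq_norm_toLp (integral_id_centered μ), centered,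
    variance_map (by fun_prop) (by fun_prop)]
  have : (L ∘ fun x ↦ x - ∫ y, y ∂μ) = fun x ↦ L x - L (∫ y, y ∂μ) := by ext; simp
  rw [this, variance_sub_const (by fun_prop)]

open scoped Pointwise

variable {K : Set E}

omit [SecondCountableTopology E] [MeasurableSpace E] [BorelSpace E] in
lemma isCompact_closedAbsConvexHull (hK : IsCompact K) : IsCompact (closedAbsConvexHull ℝ K) :=
  isCompact_closedAbsConvexHull_of_totallyBounded hK.totallyBounded

omit [CompleteSpace E] [SecondCountableTopology E] [MeasurableSpace E] [BorelSpace E] in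
lemma _root_.AbsConvex.smul_const {K : Set E} (hK : AbsConvex ℝ K) (c : ℝ) :
    AbsConvex ℝ (c • K) :=
  ⟨hK.1.smul c, hK.2.smul c⟩

/-- For independent `x`, `y` of law `centered μ`, `(x - y) / √2` has the same law, and the unknown
mean cancels in `(x + m) - (y + m)`. If both terms lie in `K`, the difference lies in `C + C = 2 •
C`. -/
lemma centered_compl_smul_le (μ : Measure E) [IsGaussian μ] (hK : IsCompact K) :
    centered μ ((2 : ℝ) • closedAbsConvexHull ℝ K)ᶜ ≤ 2 * μ Kᶜ := by
  set C := closedAbsConvexHull ℝ K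
  set m := ∫ y, y ∂μ
  set ν := centered μ with hν
  have hC : AbsConvex ℝ C := absConvex_convexClosedHull
  have hCc : IsCompact C := isCompact_closedAbsConvexHull hK
  have hKC : K ⊆ C := subset_closedAbsConvexHull
  have hCm : MeasurableSet ((2 : ℝ) • C) := (hCc.smul 2).measurableSet
  have hνK : ν {x | x + m ∈ K}ᶜ = μ Kᶜ := by
    rw [hν, centered, Measure.map_apply (by fun_prop)]
    · congr 1; ext x; simp [m]
    · exact ((measurable_add_const m) hK.measurableSet).compl
  have hrot := IsGaussian.map_rotation_eq_self (integral_id_centered μ) (-(Real.pi / 4))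
  have h1 : ν ((2 : ℝ) • C)ᶜ = (ν.prod ν) (((2 : ℝ) • C)ᶜ ×ˢ Set.univ) := by
    rw [Measure.prod_prod, measure_univ, mul_one]
  have h2 : 2 * μ Kᶜ
      = (ν.prod ν) ({x | x + m ∈ K}ᶜ ×ˢ Set.univ) + (ν.prod ν) (Set.univ ×ˢ {x | x + m ∈ K}ᶜ) := by
    rw [Measure.prod_prod, Measure.prod_prod, measure_univ, hνK, mul_one, one_mul, two_mul]
  rw [h1, h2, ← hrot, Measure.map_apply (by fun_prop) (hCm.compl.prod .univ), hrot]
  refine (measure_mono ?_).trans (measure_union_le _ _)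
  rintro ⟨x, y⟩ ⟨hxy, -⟩
  simp only [ContinuousLinearMap.rotation_apply, Real.cos_neg,
      Real.cos_pi_div_four, Real.sin_neg, Real.sin_pi_div_four, neg_smul, neg_neg] at hxy
  by_contra hcon
  simp only [Set.mem_union, Set.mem_prod, Set.mem_compl_iff, Set.mem_ofPred_eq, Set.mem_univ,
    and_true, true_and, not_or, not_not] at hcon
  refine hxy ?_
  have h3 : x - y ∈ (2 : ℝ) • C := by
    have h22 : (2 : ℝ) • C = C + C := by
      rw [show (2 : ℝ) = 1 + 1 by norm_num, hC.2.add_smul one_pos.le one_pos.le, one_smul]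
    rw [h22]
    exact ⟨x + m, hKC hcon.1, -(y + m), hC.1.neg_mem_iff.2 (hKC hcon.2), by simp [sub_eq_add_neg]⟩
  have h4 : (√2 / 2) • x + -((√2 / 2) • y) = (√2 / 2) • (x - y) := by module
  change (√2 / 2) • x + -((√2 / 2) • y) ∈ _
  rw [h4]
  refine (hC.smul_const 2).1.smul_mem ?_ h3
  rw [Real.norm_of_nonneg (by positivity), div_le_one two_pos, Real.sqrt_le_left two_pos.le]
  norm_num

/-- With positive probability both `x ∈ K` and `x - m ∈ 2 • C`; then `m = x - (x - m)`. -/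
lemma integral_mem_smul (μ : Measure E) [IsGaussian μ] (hK : IsCompact K)
    (hμ : 3 * μ Kᶜ < 1) : ∫ x, x ∂μ ∈ (3 : ℝ) • closedAbsConvexHull ℝ K := by
  set C := closedAbsConvexHull ℝ K
  set m := ∫ y, y ∂μ
  have hC : AbsConvex ℝ C := absConvex_convexClosedHull
  have hCm : MeasurableSet ((2 : ℝ) • C) :=
    ((isCompact_closedAbsConvexHull hK).smul 2).measurableSet
  have h1 : μ {x | x - m ∉ (2 : ℝ) • C} ≤ 2 * μ Kᶜ := by
    refine le_trans (le_of_eq ?_) (centered_compl_smul_le μ hK)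
    rw [centered, Measure.map_apply (by fun_prop) hCm.compl]
    rfl
  have h2 : μ ({x | x - m ∉ (2 : ℝ) • C} ∪ Kᶜ) < 1 := by
    refine (measure_union_le _ _).trans_lt (lt_of_le_of_lt ?_ hμ)
    calc _ ≤ 2 * μ Kᶜ + μ Kᶜ := by gcongr
      _ = _ := by ring
  obtain ⟨x, hx⟩ : ∃ x, x ∉ ({x | x - m ∉ (2 : ℝ) • C} ∪ Kᶜ) := by
    by_contra! hcon
    rw [Set.eq_univ_of_forall hcon, measure_univ] at h2
    exact lt_irrefl _ h2
  simp only [Set.mem_union, Set.mem_ofPred_eq, Set.mem_compl_iff, not_or, not_not] at hx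
  rw [show (3 : ℝ) = 1 + 2 by norm_num, hC.2.add_smul one_pos.le two_pos.le, one_smul]
  exact ⟨x, subset_closedAbsConvexHull hx.2, -(x - m), (hC.smul_const 2).1.neg_mem_iff.2 hx.1,
    by simp⟩

end Centering

/-! ### Uniform tightness and compactness of the means -/

section Tight

variable {E : Type*} [NormedAddCommGroup E] [NormedSpace ℝ E] [CompleteSpace E]
  [SecondCountableTopology E] [MeasurableSpace E] [BorelSpace E]

/-- Tightness of a sequence of measures, expressed through absolutely convex compact sets. -/
def ConvexTight (ν : ℕ → Measure E) : Prop :=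
  ∀ ε : ℝ, 0 < ε → ∃ K : Set E, IsCompact K ∧ AbsConvex ℝ K ∧ ∀ n, ν n Kᶜ ≤ ENNReal.ofReal ε

omit [NormedSpace ℝ E] in
lemma exists_isCompact_measure_compl_le {μ : ℕ → ProbabilityMeasure E} {μ' : ProbabilityMeasure E}
    (h : Tendsto μ atTop (𝓝 μ')) {ε : ℝ≥0∞} (hε : 0 < ε) :
    ∃ K : Set E, IsCompact K ∧ ∀ n, (μ n : Measure E) Kᶜ ≤ ε := by
  have hcomp : IsCompact (closure (Set.range μ)) :=
    h.isCompact_insert_range.of_isClosed_subset isClosed_closure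
      (closure_minimal (Set.subset_insert _ _) h.isCompact_insert_range.isClosed)
  obtain ⟨K, hK, hKμ⟩ := isTightMeasureSet_iff_exists_isCompact_measure_compl_le.1
    (isTightMeasureSet_of_isCompact_closure hcomp) ε hε
  exact ⟨K, hK, fun n ↦ hKμ _ ⟨μ n, ⟨n, rfl⟩, rfl⟩⟩

variable {μ : ℕ → ProbabilityMeasure E} {μ' : ProbabilityMeasure E}
  [∀ n, IsGaussian (μ n : Measure E)]

lemma convexTight_centered (h : Tendsto μ atTop (𝓝 μ')) :
    ConvexTight fun n ↦ centered (μ n : Measure E) := by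
  intro ε hε
  obtain ⟨K, hK, hKμ⟩ := exists_isCompact_measure_compl_le h
    (ENNReal.ofReal_pos.2 (half_pos hε))
  refine ⟨_, (isCompact_closedAbsConvexHull hK).smul 2,
    absConvex_convexClosedHull.smul_const 2, fun n ↦ (centered_compl_smul_le _ hK).trans ?_⟩
  calc 2 * (μ n : Measure E) Kᶜ ≤ 2 * ENNReal.ofReal (ε / 2) := by gcongr; exact hKμ n
    _ = ENNReal.ofReal ε := by
      rw [ofReal_div_two, ENNReal.mul_div_cancel (by simp) (by simp)]

lemma exists_isCompact_forall_integral_mem (h : Tendsto μ atTop (𝓝 μ')) :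
    ∃ K : Set E, IsCompact K ∧ AbsConvex ℝ K ∧ ∀ n, ∫ x, x ∂(μ n : Measure E) ∈ K := by
  obtain ⟨K, hK, hKμ⟩ := exists_isCompact_measure_compl_le h
    (ENNReal.ofReal_pos.2 (by norm_num : (0 : ℝ) < 1 / 4))
  refine ⟨_, (isCompact_closedAbsConvexHull hK).smul 3,
    absConvex_convexClosedHull.smul_const 3, fun n ↦ integral_mem_smul _ hK ?_⟩
  calc 3 * (μ n : Measure E) Kᶜ ≤ 3 * ENNReal.ofReal (1 / 4) := by gcongr; exact hKμ n
    _ = ENNReal.ofReal (3 / 4) := by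
      rw [← ENNReal.ofReal_ofNat, ← ENNReal.ofReal_mul (by simp)]; norm_num
    _ < 1 := by rw [ENNReal.ofReal_lt_one]; norm_num

end Tight

/-! ### Limits of Gaussian laws and of their covariances -/

section Limit

variable {E : Type*} [NormedAddCommGroup E] [NormedSpace ℝ E] [CompleteSpace E]
  [SecondCountableTopology E] [MeasurableSpace E] [BorelSpace E]
  {μ : ℕ → ProbabilityMeasure E} {μ' : ProbabilityMeasure E}

omit [CompleteSpace E] [SecondCountableTopology E] in
lemma tendsto_charFunDual (h : Tendsto μ atTop (𝓝 μ')) (L : StrongDual ℝ E) :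
    Tendsto (fun n ↦ charFunDual (μ n : Measure E) L) atTop
      (𝓝 (charFunDual (μ' : Measure E) L)) :=
  (ProbabilityMeasure.tendsto_iff_forall_integral_rclike_tendsto ℂ).1 h _

variable [∀ n, IsGaussian (μ n : Measure E)]

omit [CompleteSpace E] [SecondCountableTopology E] in
lemma norm_charFunDual (μ : Measure E) [IsGaussian μ] (L : StrongDual ℝ E) :
    ‖charFunDual μ L‖ = Real.exp (-(Var[L; μ] / 2)) := by
  rw [IsGaussian.charFunDual_eq, Complex.norm_exp, integral_complex_ofReal]
  simp

lemma tendsto_of_tendsto_exp_neg_half {a : ℕ → ℝ} {c : ℝ} (hc : c ≠ 0)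
    (h : Tendsto (fun n ↦ Real.exp (-(a n / 2))) atTop (𝓝 c)) :
    Tendsto a atTop (𝓝 (-2 * Real.log c)) := by
  refine ((h.log hc).const_mul (-2)).congr fun n ↦ ?_
  rw [Real.log_exp]
  ring

omit [CompleteSpace E] [SecondCountableTopology E] in
lemma tendsto_variance (h : Tendsto μ atTop (𝓝 μ')) [IsGaussian (μ' : Measure E)]
    (L : StrongDual ℝ E) :
    Tendsto (fun n ↦ Var[L; (μ n : Measure E)]) atTop (𝓝 Var[L; (μ' : Measure E)]) := by
  have h1 := (tendsto_charFunDual h L).norm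
  simp_rw [norm_charFunDual] at h1
  convert! tendsto_of_tendsto_exp_neg_half (Real.exp_ne_zero _) h1 using 2
  rw [Real.log_exp]
  ring

omit [CompleteSpace E] [SecondCountableTopology E] in
lemma exists_tendsto_variance (h : Tendsto μ atTop (𝓝 μ')) (L : StrongDual ℝ E) :
    ∃ v, Tendsto (fun n ↦ Var[L; (μ n : Measure E)]) atTop (𝓝 v) := by
  have hcont : Continuous (charFun ((μ' : Measure E).map L)) := by
    have : IsProbabilityMeasure ((μ' : Measure E).map L) :=
      Measure.isProbabilityMeasure_map (by fun_prop)
    exact continuous_charFun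
  have h0 : charFun ((μ' : Measure E).map L) 0 ≠ 0 := by
    rw [charFun_map_eq_charFunDual_smul, charFunDual_apply]
    simp
  -- The limit is not yet known to be Gaussian, so its characteristic function might vanish
  -- somewhere; near `0` it does not, and one such `t ≠ 0` is enough to recover the variance.
  obtain ⟨t, ht, ht0⟩ := (((hcont.continuousAt.eventually_ne h0).filter_mono
    nhdsWithin_le_nhds).and (self_mem_nhdsWithin (a := (0 : ℝ)) (s := {0}ᶜ))).exists
  rw [charFun_map_eq_charFunDual_smul] at ht
  have h1 := (tendsto_charFunDual h (t • L)).norm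
  simp_rw [norm_charFunDual] at h1
  have h2 := (tendsto_of_tendsto_exp_neg_half (norm_ne_zero_iff.2 ht) h1).const_mul (t ^ 2)⁻¹
  refine ⟨_, h2.congr fun n ↦ ?_⟩
  have : (⇑(t • L) : E → ℝ) = fun x ↦ t * L x := by ext; simp
  rw [this, variance_const_mul]
  have : t ≠ 0 := ht0
  field_simp

/-- A limit in law of Gaussian measures is Gaussian. -/
theorem isGaussian_of_tendsto (h : Tendsto μ atTop (𝓝 μ')) : IsGaussian (μ' : Measure E) := by
  obtain ⟨K, hK, -, hKm⟩ := exists_isCompact_forall_integral_mem h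
  -- Convergence of the means is not needed: a limit along an ultrafilter identifies the
  -- characteristic function.
  obtain ⟨m, -, hm⟩ := hK.ultrafilter_le_nhds
    ((hyperfilter ℕ).map fun n ↦ ∫ x, x ∂(μ n : Measure E))
    (le_principal_iff.2 (mem_map.2 (univ_mem' hKm)))
  have hm' : Tendsto (fun n ↦ ∫ x, x ∂(μ n : Measure E)) (hyperfilter ℕ : Filter ℕ) (𝓝 m) := hm
  refine isGaussian_of_map_eq_gaussianReal fun L ↦ ?_
  obtain ⟨v, hv⟩ := exists_tendsto_variance h L
  have hv0 : 0 ≤ v := ge_of_tendsto' hv fun n ↦ variance_nonneg _ _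
  have : IsProbabilityMeasure ((μ' : Measure E).map L) :=
    Measure.isProbabilityMeasure_map (by fun_prop)
  refine ⟨L m, v.toNNReal, Measure.ext_of_charFun ?_⟩
  ext t
  rw [charFun_map_eq_charFunDual_smul, charFun_gaussianReal, Real.coe_toNNReal v hv0]
  refine tendsto_nhds_unique ((tendsto_charFunDual h (t • L)).mono_left
    Nat.hyperfilter_le_atTop) ?_
  have h1 : ∀ n, charFunDual (μ n : Measure E) (t • L)
      = Complex.exp (t * ((L (∫ x, x ∂(μ n : Measure E)) : ℝ) : ℂ) * Complex.I
        - ((Var[L; (μ n : Measure E)] : ℝ) : ℂ) * t ^ 2 / 2) := fun n ↦ by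
    rw [IsGaussian.charFunDual_eq, integral_complex_ofReal, IsGaussian.integral_dual]
    have : (⇑(t • L) : E → ℝ) = fun x ↦ t * L x := by ext; simp
    rw [this, variance_const_mul]
    congr 1
    simp
    ring
  simp_rw [h1]
  have h2 := (Complex.continuous_ofReal.tendsto _).comp ((L.continuous.tendsto m).comp hm')
  have h3 := (Complex.continuous_ofReal.tendsto _).comp (hv.mono_left Nat.hyperfilter_le_atTop)
  exact (((h2.const_mul _).mul_const _).sub ((h3.mul_const _).div_const _)).cexp

lemma _root_.MapClusterPt.eq_of_tendsto {X α : Type*} [TopologicalSpace X] [T2Space X]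
    {l : Filter α} {u : α → X} {x y : X} (hx : MapClusterPt x l u) (hy : Tendsto u l (𝓝 y)) :
    x = y :=
  have : NeBot (𝓝 x ⊓ 𝓝 y) := NeBot.mono hx (inf_le_inf_left _ hy)
  eq_of_nhds_neBot this

open scoped Pointwise in
/-- For Gaussian measures converging in law, the covariance operators converge pointwise in norm. -/
theorem tendsto_covOp {ν : ℕ → Measure E} {ν' : Measure E} [∀ n, IsGaussian (ν n)]
    [IsGaussian ν'] (h0 : ∀ n, (ν n)[id] = 0) (ht : ConvexTight ν)
    (hv : ∀ L : StrongDual ℝ E,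
      Tendsto (fun n ↦ ‖L.toLp (ν n) 2‖ ^ 2) atTop (𝓝 (‖L.toLp ν' 2‖ ^ 2)))
    (L : StrongDual ℝ E) : Tendsto (fun n ↦ covOp (ν n) L) atTop (𝓝 (covOp ν' L)) := by
  obtain ⟨R, hR⟩ := (hv L).bddAbove_range
  obtain ⟨K, hK, hKc, hKν⟩ := ht (Real.exp (-(R / 2)) / 4) (by positivity)
  have hR0 : 0 ≤ R := (sq_nonneg _).trans (hR ⟨0, rfl⟩)
  -- Otherwise `K` and its translate by `-covOp (ν n) L` are disjoint, so the translate has mass at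
  -- most `exp (-R/2) / 4`, while Cameron–Martin gives at least `3/4 * exp (-R/2)`.
  have hmem : ∀ n, covOp (ν n) L ∈ K + -K := fun n ↦ by
    have h1 := exp_mul_measure_le_measure_add_covOp (h0 n) L hK.measurableSet
      fun _ ↦ hKc.1.neg_mem_iff
    have h2 : (ν n).real Kᶜ ≤ Real.exp (-(R / 2)) / 4 :=
      ENNReal.toReal_le_of_le_ofReal (by positivity) (hKν n)
    have h3 : Real.exp (-(R / 2)) * (ν n).real K ≤ (ν n).real {x | x + covOp (ν n) L ∈ K} := by
      have := ENNReal.toReal_mono (by finiteness) h1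
      rw [ENNReal.toReal_mul, ENNReal.toReal_ofReal (Real.exp_nonneg _)] at this
      refine le_trans ?_ this
      have hle : ‖L.toLp (ν n) 2‖ ^ 2 ≤ R := hR ⟨n, rfl⟩
      rw [Measure.real]
      gcongr
    have hexp : Real.exp (-(R / 2)) ≤ 1 := Real.exp_le_one_iff.2 (by linarith)
    have h4 : (ν n).real K = 1 - (ν n).real Kᶜ := by
      rw [probReal_compl_eq_one_sub hK.measurableSet]; ring
    have hpos := Real.exp_pos (-(R / 2))
    by_contra hcon
    have hsub : {x | x + covOp (ν n) L ∈ K} ⊆ Kᶜ := fun x hx hxK ↦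
      hcon ⟨x + covOp (ν n) L, hx, -x, by simpa using hxK, by simp⟩
    have h5 : (ν n).real {x | x + covOp (ν n) L ∈ K} ≤ (ν n).real Kᶜ := measureReal_mono hsub
    nlinarith
  have hinner : ∀ M : StrongDual ℝ E,
      Tendsto (fun n ↦ M (covOp (ν n) L)) atTop (𝓝 (M (covOp ν' L))) := fun M ↦ by
    -- Polarization turns convergence of variances into weak convergence; compactness of `K + -K`
    -- upgrades it to norm convergence.
    have key : ∀ (ρ : Measure E) [IsGaussian ρ], M (covOp ρ L)
        = (‖(M + L).toLp ρ 2‖ ^ 2 - ‖M.toLp ρ 2‖ ^ 2 - ‖L.toLp ρ 2‖ ^ 2) / 2 := fun ρ _ ↦ by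
      rw [apply_covOp, map_add, norm_add_sq_real]
      ring
    simp_rw [key]
    exact (((hv _).sub (hv _)).sub (hv _)).div_const _
  refine (hK.add hK.neg).tendsto_nhds_of_unique_mapClusterPt (.of_forall hmem) fun x _ hx ↦ ?_
  refine (SeparatingDual.eq_iff_forall_dual_eq (R := ℝ)).2 fun M ↦ ?_
  exact (hx.continuousAt_comp M.continuous.continuousAt).eq_of_tendsto (hinner M)

end Limit

/-! ### Exponential bounds on the logarithmic scale -/

section LogScale

lemma inv_mul_log_le {g s : ℝ} (hg : 0 < g) {p : ℝ≥0∞}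
    (hp : p ≤ ENNReal.ofReal (Real.exp (-(g * s)))) :
    ((g⁻¹ : ℝ) : EReal) * ENNReal.log p ≤ ((-s : ℝ) : EReal) := by
  have h1 : ENNReal.log p ≤ ((-(g * s) : ℝ) : EReal) := by
    refine (ENNReal.log_monotone hp).trans (le_of_eq ?_)
    rw [ENNReal.log_ofReal_of_pos (Real.exp_pos _), Real.log_exp]
  refine (mul_le_mul_of_nonneg_left h1 (by exact_mod_cast (inv_pos.2 hg).le)).trans (le_of_eq ?_)
  rw [← EReal.coe_mul]
  congr 1
  field_simp

lemma le_inv_mul_log {g s : ℝ} (hg : 0 < g) {p : ℝ≥0∞}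
    (hp : ENNReal.ofReal (Real.exp (-(g * s))) ≤ p) :
    ((-s : ℝ) : EReal) ≤ ((g⁻¹ : ℝ) : EReal) * ENNReal.log p := by
  have h1 : ((-(g * s) : ℝ) : EReal) ≤ ENNReal.log p := by
    refine le_trans (le_of_eq ?_) (ENNReal.log_monotone hp)
    rw [ENNReal.log_ofReal_of_pos (Real.exp_pos _), Real.log_exp]
  refine le_trans (le_of_eq ?_)
    (mul_le_mul_of_nonneg_left h1 (by exact_mod_cast (inv_pos.2 hg).le))
  rw [← EReal.coe_mul]
  congr 1
  field_simp

lemma eventually_mul_exp_le {g : ℕ → ℝ} (hg : Tendsto g atTop atTop) (N : ℝ) {s t : ℝ}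
    (hst : s < t) : ∀ᶠ n in atTop, N * Real.exp (-(g n * t)) ≤ Real.exp (-(g n * s)) := by
  have h1 : Tendsto (fun n ↦ Real.exp (g n * (t - s))) atTop atTop :=
    Real.tendsto_exp_atTop.comp (hg.atTop_mul_const (sub_pos.2 hst))
  filter_upwards [h1.eventually_ge_atTop N] with n hn
  calc N * Real.exp (-(g n * t)) ≤ Real.exp (g n * (t - s)) * Real.exp (-(g n * t)) := by gcongr
    _ = Real.exp (-(g n * s)) := by rw [← Real.exp_add]; congr 1; ring

end LogScale

/-! ### The upper and lower large deviation bounds -/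

section LDP

open scoped Pointwise

variable {E : Type*} [NormedAddCommGroup E] [NormedSpace ℝ E] [CompleteSpace E]
  [SecondCountableTopology E] [MeasurableSpace E] [BorelSpace E]
  {ν : ℕ → Measure E} {ν' : Measure E} [∀ n, IsGaussian (ν n)] [IsGaussian ν']
  {m : ℕ → E} {K : Set E} {g : ℕ → ℝ}

/-- The law of `c • (Y + m)`, where `Y` has law `ν`. -/
noncomputable def rescaled (ν : Measure E) (m : E) (c : ℝ) : Measure E :=
  ν.map fun y ↦ c • (y + m)

omit [CompleteSpace E] [SecondCountableTopology E] in
lemma rescaled_apply (ν : Measure E) (m : E) (c : ℝ) {A : Set E} (hA : MeasurableSet A) :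
    rescaled ν m c A = ν {y | c • (y + m) ∈ A} :=
  Measure.map_apply (by fun_prop) hA

instance (ν : Measure E) [IsProbabilityMeasure ν] (m : E) (c : ℝ) :
    IsProbabilityMeasure (rescaled ν m c) :=
  Measure.isProbabilityMeasure_map (by fun_prop)

omit [CompleteSpace E] [SecondCountableTopology E] [MeasurableSpace E] [BorelSpace E] in
lemma tendsto_inv_sqrt_smul (hK : IsCompact K) (hm : ∀ n, m n ∈ K) (hg : Tendsto g atTop atTop) :
    Tendsto (fun n ↦ (√(g n))⁻¹ • m n) atTop (𝓝 0) := by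
  obtain ⟨R, hR⟩ := hK.isBounded.exists_norm_le
  have h1 : Tendsto (fun n ↦ (√(g n))⁻¹) atTop (𝓝 0) :=
    tendsto_inv_atTop_zero.comp (Real.tendsto_sqrt_atTop.comp hg)
  exact h1.zero_smul_isBoundedUnder_le
    (isBoundedUnder_of ⟨R, fun n ↦ hR _ (hm n)⟩)

/-- Exponential tightness of rescaled tight Gaussian measures. -/
lemma exists_isCompact_rescaled_compl_le (h0 : ∀ n, (ν n)[id] = 0) (ht : ConvexTight ν)
    (hK : IsCompact K) (hm : ∀ n, m n ∈ K) (hg : Tendsto g atTop atTop) {M : ℝ} (hM : 1 ≤ M) :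
    ∃ A : Set E, IsCompact A ∧ ∀ᶠ n in atTop,
      rescaled (ν n) (m n) (√(g n))⁻¹ Aᶜ ≤ ENNReal.ofReal (Real.exp (-(g n * M))) := by
  obtain ⟨K₀, hK₀, -, hK₀ν⟩ := ht (1 / 4) (by norm_num)
  set C := closedAbsConvexHull ℝ (K₀ ∪ K)
  have hC : AbsConvex ℝ C := absConvex_convexClosedHull
  have hCc : IsCompact C := isCompact_closedAbsConvexHull (hK₀.union hK)
  have hsub : K₀ ∪ K ⊆ C := subset_closedAbsConvexHull
  set a := 4 * √(2 * M)
  have ha : 0 ≤ a := by positivity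
  -- Fernique at level `g n * M` gives the radius `√(g n) * a`; the extra `1` absorbs the rescaled
  -- mean.
  have hA : IsCompact ((a + 1) • C) := hCc.smul _
  refine ⟨_, hA, ?_⟩
  filter_upwards [hg.eventually_ge_atTop 1] with n hn
  rw [rescaled_apply _ _ _ hA.measurableSet.compl]
  have hT : 1 ≤ g n * M := one_le_mul_of_one_le_of_one_le hn hM
  refine le_trans (measure_mono ?_) (measure_compl_smul_le_exp (h0 n) hC hCc.isClosed
    ((measure_mono (Set.compl_subset_compl.2 (Set.subset_union_left.trans hsub))).trans
      (hK₀ν n)) hT)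
  intro y hy hyC
  refine hy ?_
  have hr : 1 ≤ √(g n) := Real.one_le_sqrt.2 hn
  rw [smul_add, hC.2.add_smul ha zero_le_one, one_smul]
  refine Set.add_mem_add ?_ (hC.1.smul_mem ?_ (hsub (Or.inr (hm n))))
  · have h1 : 4 * √(2 * (g n * M)) = √(g n) * a := by
      rw [show 2 * (g n * M) = g n * (2 * M) by ring, Real.sqrt_mul (by linarith)]
      ring
    rw [h1, mul_smul] at hyC
    rwa [← Set.mem_smul_set_iff_inv_smul_mem₀ (by positivity)]
  · rw [norm_inv, Real.norm_of_nonneg (by positivity)]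
    exact inv_le_one_of_one_le₀ hr

omit [IsGaussian ν'] in
/-- The exponential Chebyshev bound on a half-space. -/
lemma eventually_rescaled_halfSpace_le (h0 : ∀ n, (ν n)[id] = 0)
    (hv : ∀ L : StrongDual ℝ E,
      Tendsto (fun n ↦ ‖L.toLp (ν n) 2‖ ^ 2) atTop (𝓝 (‖L.toLp ν' 2‖ ^ 2)))
    (hK : IsCompact K) (hm : ∀ n, m n ∈ K) (hg : Tendsto g atTop atTop) (L : StrongDual ℝ E)
    {s t : ℝ} (hst : s < t - ‖L.toLp ν' 2‖ ^ 2 / 2) :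
    ∀ᶠ n in atTop, rescaled (ν n) (m n) (√(g n))⁻¹ {x | t < L x}
      ≤ ENNReal.ofReal (Real.exp (-(g n * s))) := by
  have hlim : Tendsto (fun n ↦ t - L ((√(g n))⁻¹ • m n) - ‖L.toLp (ν n) 2‖ ^ 2 / 2) atTop
      (𝓝 (t - L 0 - ‖L.toLp ν' 2‖ ^ 2 / 2)) :=
    (tendsto_const_nhds.sub ((L.continuous.tendsto 0).comp
      (tendsto_inv_sqrt_smul hK hm hg))).sub ((hv L).div_const 2)
  rw [map_zero, sub_zero] at hlim
  filter_upwards [hlim.eventually_const_lt hst, hg.eventually_gt_atTop 0] with n hn hgn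
  have hr : 0 < √(g n) := Real.sqrt_pos.2 hgn
  have hr2 : √(g n) * √(g n) = g n := Real.mul_self_sqrt hgn.le
  rw [rescaled_apply _ _ _ (measurableSet_lt (by fun_prop) (by fun_prop))]
  have hsub : {y | (√(g n))⁻¹ • (y + m n) ∈ {x | t < L x}}
      ⊆ {y | √(g n) * t - L (m n) ≤ L y} := fun y hy ↦ by
    simp only [Set.mem_ofPred_eq, map_smul, map_add, smul_eq_mul] at hy ⊢
    rw [← div_eq_inv_mul, lt_div_iff₀ hr] at hy
    linarith
  refine (measure_mono hsub).trans ?_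
  have hint : Integrable (fun y ↦ Real.exp (√(g n) * L y)) (ν n) := by
    simpa using integrable_exp_dual (μ := ν n) (√(g n) • L)
  have hmgf : mgf L (ν n) √(g n) = Real.exp (g n * (‖L.toLp (ν n) 2‖ ^ 2 / 2)) := by
    have := integral_exp_dual (h0 n) (√(g n) • L)
    rw [map_smul, norm_smul, mul_pow, Real.norm_of_nonneg hr.le, Real.sq_sqrt hgn.le] at this
    rw [mgf]
    simpa [mul_div_assoc] using this
  -- The Chebyshev parameter `√(g n)` puts the linear and quadratic terms both at scale `g n`.
  have h1 := measure_ge_le_exp_mul_mgf (√(g n) * t - L (m n)) hr.le hint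
  rw [hmgf, ← Real.exp_add] at h1
  rw [← ofReal_measureReal]
  refine ENNReal.ofReal_le_ofReal (h1.trans (Real.exp_le_exp.2 ?_))
  have h2 : √(g n) * L (m n) = g n * L ((√(g n))⁻¹ • m n) := by
    rw [map_smul, smul_eq_mul]
    nth_rw 2 [← hr2]
    field_simp
  have h3 := mul_le_mul_of_nonneg_left hn.le hgn.le
  have h4 : √(g n) * (√(g n) * t) = g n * t := by rw [← mul_assoc, hr2]
  nlinarith

lemma eventually_rescaled_le_of_isClosed (h0 : ∀ n, (ν n)[id] = 0) (ht : ConvexTight ν)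
    (hv : ∀ L : StrongDual ℝ E,
      Tendsto (fun n ↦ ‖L.toLp (ν n) 2‖ ^ 2) atTop (𝓝 (‖L.toLp ν' 2‖ ^ 2)))
    (hK : IsCompact K) (hm : ∀ n, m n ∈ K) (hg : Tendsto g atTop atTop) {F : Set E}
    (hF : IsClosed F) {s : ℝ} (hs : 0 ≤ s)
    (hsF : ENNReal.ofReal s < ⨅ x ∈ F, rkhsNorm ν' x ^ 2 / 2) :
    ∀ᶠ n in atTop, rescaled (ν n) (m n) (√(g n))⁻¹ F
      ≤ ENNReal.ofReal (Real.exp (-(g n * s))) := by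
  obtain ⟨t, ht0, hst, htF⟩ := ENNReal.lt_iff_exists_real_btwn.1 hsF
  -- The gap between `s` and `t` pays for the number of half-spaces in the cover.
  have hst' : s < t := (ENNReal.ofReal_lt_ofReal_iff_of_nonneg hs).1 hst
  obtain ⟨A, hA, hAν⟩ := exists_isCompact_rescaled_compl_le h0 ht hK hm hg (le_max_right t 1)
  have hcover : ∃ N : ℕ, ∀ᶠ n in atTop, rescaled (ν n) (m n) (√(g n))⁻¹ (A ∩ F)
      ≤ N * ENNReal.ofReal (Real.exp (-(g n * t))) := by
    refine (hA.inter_right hF).induction_on (p := fun B ↦ ∃ N : ℕ, ∀ᶠ n in atTop,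
      rescaled (ν n) (m n) (√(g n))⁻¹ B ≤ N * ENNReal.ofReal (Real.exp (-(g n * t)))) ?_ ?_ ?_ ?_
    · exact ⟨0, by simp⟩
    · rintro B B' hBB' ⟨N, hN⟩
      exact ⟨N, hN.mono fun n hn ↦ (measure_mono hBB').trans hn⟩
    · rintro B B' ⟨N, hN⟩ ⟨N', hN'⟩
      refine ⟨N + N', ?_⟩
      filter_upwards [hN, hN'] with n hn hn'
      rw [Nat.cast_add, add_mul]
      exact (measure_union_le _ _).trans (add_le_add hn hn')
    · intro x hx
      have htx : ENNReal.ofReal t < rkhsNorm ν' x ^ 2 / 2 :=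
        htF.trans_le (iInf₂_le x hx.2)
      obtain ⟨L, hL⟩ := exists_lt_apply_sub IsGaussian.memLp_two_id ht0 htx
      obtain ⟨u, hu1, hu2⟩ := exists_between (lt_sub_iff_add_lt.1 hL)
      refine ⟨{y | u < L y}, mem_nhdsWithin_of_mem_nhds
        ((isOpen_lt continuous_const L.continuous).mem_nhds hu2), 1, ?_⟩
      simpa using eventually_rescaled_halfSpace_le h0 hv hK hm hg L (lt_sub_iff_add_lt.2 hu1)
  obtain ⟨N, hN⟩ := hcover
  filter_upwards [hN, hAν, eventually_mul_exp_le hg (N + 1) hst', hg.eventually_ge_atTop 0]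
    with n hn hn' hexp hgn
  calc rescaled (ν n) (m n) (√(g n))⁻¹ F
      ≤ rescaled (ν n) (m n) (√(g n))⁻¹ (A ∩ F) + rescaled (ν n) (m n) (√(g n))⁻¹ Aᶜ := by
        refine (measure_mono fun x hx ↦ ?_).trans (measure_union_le _ _)
        by_cases hxA : x ∈ A
        exacts [Or.inl ⟨hxA, hx⟩, Or.inr hxA]
    _ ≤ N * ENNReal.ofReal (Real.exp (-(g n * t))) + ENNReal.ofReal (Real.exp (-(g n * t))) := by
        refine add_le_add hn (hn'.trans (ENNReal.ofReal_le_ofReal (Real.exp_le_exp.2 ?_)))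
        have := mul_le_mul_of_nonneg_left (le_max_left t 1) hgn
        linarith
    _ = ENNReal.ofReal ((N + 1) * Real.exp (-(g n * t))) := by
        rw [ENNReal.ofReal_mul (by positivity), ENNReal.ofReal_add (by positivity) (by simp),
          ENNReal.ofReal_natCast, ENNReal.ofReal_one, add_mul, one_mul]
    _ ≤ _ := ENNReal.ofReal_le_ofReal hexp

/-- A ball of radius `√(g n) * (ε / 2)` eventually has mass at least `1/2`; moving it by `√(g n) •
covOp (ν n) L` costs `exp (-(g n * ‖L‖² / 2))`, and rescaling brings it into `G`. -/
lemma eventually_le_rescaled_of_isOpen (h0 : ∀ n, (ν n)[id] = 0) (ht : ConvexTight ν)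
    (hv : ∀ L : StrongDual ℝ E,
      Tendsto (fun n ↦ ‖L.toLp (ν n) 2‖ ^ 2) atTop (𝓝 (‖L.toLp ν' 2‖ ^ 2)))
    (hK : IsCompact K) (hm : ∀ n, m n ∈ K) (hg : Tendsto g atTop atTop) {G : Set E}
    (hG : IsOpen G) {s : ℝ} (hsG : ⨅ x ∈ G, rkhsNorm ν' x ^ 2 / 2 < ENNReal.ofReal s) :
    ∀ᶠ n in atTop, ENNReal.ofReal (Real.exp (-(g n * s)))
      ≤ rescaled (ν n) (m n) (√(g n))⁻¹ G := by
  obtain ⟨x, hx⟩ := iInf_lt_iff.1 hsG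
  obtain ⟨hxG, hx⟩ := iInf_lt_iff.1 hx
  obtain ⟨L, hLG, hLs⟩ := exists_covOp_mem IsGaussian.memLp_two_id hx hG hxG
  obtain ⟨ε, hε, hball⟩ := Metric.isOpen_iff.1 hG _ hLG
  obtain ⟨t, hLt, hts⟩ := exists_between hLs
  obtain ⟨K₀, hK₀, -, hK₀ν⟩ := ht (1 / 2) (by norm_num)
  obtain ⟨R, hR⟩ := hK₀.isBounded.exists_norm_le
  have hcenter : Tendsto (fun n ↦ (√(g n))⁻¹ • m n + covOp (ν n) L) atTop
      (𝓝 (covOp ν' L)) := by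
    simpa using (tendsto_inv_sqrt_smul hK hm hg).add (tendsto_covOp h0 ht hv L)
  have hrad : Tendsto (fun n ↦ √(g n) * (ε / 2)) atTop atTop :=
    (Real.tendsto_sqrt_atTop.comp hg).atTop_mul_const (half_pos hε)
  filter_upwards [((hv L).div_const 2).eventually_lt_const hLt, hrad.eventually_gt_atTop R,
    hcenter.eventually (Metric.ball_mem_nhds _ (half_pos hε)), hg.eventually_gt_atTop 0,
    eventually_mul_exp_le hg 2 hts] with n hvn hRn hcn hgn hexp
  have hr : 0 < √(g n) := Real.sqrt_pos.2 hgn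
  set B := Metric.ball (0 : E) (√(g n) * (ε / 2))
  have hBν : ENNReal.ofReal (1 / 2) ≤ ν n B := by
    have h1 : (ν n).real K₀ᶜ ≤ 1 / 2 := ENNReal.toReal_le_of_le_ofReal (by norm_num) (hK₀ν n)
    rw [probReal_compl_eq_one_sub hK₀.measurableSet] at h1
    have h2 : (ν n).real K₀ ≤ (ν n).real B :=
      measureReal_mono fun x hx ↦ by simpa [B] using (hR x hx).trans_lt hRn
    rw [← ofReal_measureReal]
    exact ENNReal.ofReal_le_ofReal (by linarith)
  -- The shift lemma bounds the mass of `B - covOp`, so the negative functional is used to move the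
  -- ball towards `+covOp (ν n) L`.
  have hshift := exp_mul_measure_le_measure_add_covOp (h0 n) (-(√(g n) • L))
    (B := B) Metric.isOpen_ball.measurableSet (fun x ↦ by simp [B])
  have hnorm : ‖(-(√(g n) • L)).toLp (ν n) 2‖ ^ 2 / 2 = g n * (‖L.toLp (ν n) 2‖ ^ 2 / 2) := by
    rw [map_neg, norm_neg, map_smul, norm_smul, mul_pow, Real.norm_of_nonneg hr.le,
      Real.sq_sqrt hgn.le, mul_div_assoc]
  have hcov : covOp (ν n) (-(√(g n) • L)) = -(√(g n) • covOp (ν n) L) := by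
    rw [← neg_smul (√(g n)) L, covOp_smul, neg_smul]
  rw [hnorm, hcov] at hshift
  rw [rescaled_apply _ _ _ hG.measurableSet]
  calc ENNReal.ofReal (Real.exp (-(g n * s)))
      ≤ ENNReal.ofReal (Real.exp (-(g n * (‖L.toLp (ν n) 2‖ ^ 2 / 2))))
        * ENNReal.ofReal (1 / 2) := by
        rw [← ENNReal.ofReal_mul (Real.exp_nonneg _)]
        refine ENNReal.ofReal_le_ofReal ?_
        have h1 : Real.exp (-(g n * t)) ≤ Real.exp (-(g n * (‖L.toLp (ν n) 2‖ ^ 2 / 2))) :=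
          Real.exp_le_exp.2 (neg_le_neg (mul_le_mul_of_nonneg_left hvn.le hgn.le))
        linarith
    _ ≤ ENNReal.ofReal (Real.exp (-(g n * (‖L.toLp (ν n) 2‖ ^ 2 / 2)))) * ν n B := by gcongr
    _ ≤ ν n {x | x + -(√(g n) • covOp (ν n) L) ∈ B} := hshift
    _ ≤ _ := by
        refine measure_mono fun y hy ↦ hball ?_
        have h1 : ‖(√(g n))⁻¹ • (y + -(√(g n) • covOp (ν n) L))‖ < ε / 2 := by
          rw [norm_smul, norm_inv, Real.norm_of_nonneg hr.le, inv_mul_lt_iff₀ hr]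
          simpa [B] using hy
        rw [dist_eq_norm] at hcn
        rw [Metric.mem_ball, dist_eq_norm]
        have h2 : (√(g n))⁻¹ • (y + m n) - covOp ν' L
            = (√(g n))⁻¹ • (y + -(√(g n) • covOp (ν n) L))
              + ((√(g n))⁻¹ • m n + covOp (ν n) L - covOp ν' L) := by
          rw [smul_add, smul_add, smul_neg, inv_smul_smul₀ hr.ne']
          abel
        rw [h2]
        exact (norm_add_le _ _).trans_lt (by linarith)

/-- The large deviation principle for rescaled Gaussian measures whose covariances converge. -/
theorem satisfiesLDP_rescaled (h0 : ∀ n, (ν n)[id] = 0) (ht : ConvexTight ν)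
    (hv : ∀ L : StrongDual ℝ E,
      Tendsto (fun n ↦ ‖L.toLp (ν n) 2‖ ^ 2) atTop (𝓝 (‖L.toLp ν' 2‖ ^ 2)))
    (hK : IsCompact K) (hm : ∀ n, m n ∈ K) (hpos : ∀ n, 0 < g n) (hg : Tendsto g atTop atTop) :
    SatisfiesLDP (fun n ↦ rescaled (ν n) (m n) (√(g n))⁻¹) g
      (fun x ↦ rkhsNorm ν' x ^ 2 / 2) where
  lowerSemicontinuous := lowerSemicontinuous_rkhsNorm_sq IsGaussian.memLp_two_id
  upper F hF := by
    by_contra! hcon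
    -- A real level strictly between the two sides also covers an infinite infimum.
    obtain ⟨c, hc1, hc2⟩ := EReal.lt_iff_exists_real_btwn.1 hcon
    refine hc2.not_ge (limsup_le_of_le (by isBoundedDefault) ?_)
    have hlt : ((-c : ℝ) : EReal) < ((⨅ x ∈ F, rkhsNorm ν' x ^ 2 / 2 : ℝ≥0∞) : EReal) := by
      rw [EReal.coe_neg]
      exact EReal.neg_lt_comm.1 hc1
    have hev : ∀ᶠ n in atTop, rescaled (ν n) (m n) (√(g n))⁻¹ F
        ≤ ENNReal.ofReal (Real.exp (-(g n * -c))) := by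
      rcases le_or_gt 0 (-c) with hc | hc
      · refine eventually_rescaled_le_of_isClosed h0 ht hv hK hm hg hF hc ?_
        rw [← EReal.coe_ennreal_lt_coe_ennreal_iff, EReal.coe_ennreal_ofReal, max_eq_left hc]
        exact hlt
      · refine .of_forall fun n ↦ prob_le_one.trans ?_
        rw [ENNReal.one_le_ofReal, Real.one_le_exp_iff]
        nlinarith [hpos n]
    filter_upwards [hev] with n hn
    simpa using inv_mul_log_le (hpos n) hn
  lower G hG := by
    by_contra! hcon
    obtain ⟨c, hc1, hc2⟩ := EReal.lt_iff_exists_real_btwn.1 hcon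
    refine hc1.not_ge (le_liminf_of_le (by isBoundedDefault) ?_)
    have hlt : ((⨅ x ∈ G, rkhsNorm ν' x ^ 2 / 2 : ℝ≥0∞) : EReal) < ((-c : ℝ) : EReal) := by
      rw [EReal.coe_neg]
      exact EReal.lt_neg_comm.1 hc2
    have hc0 : 0 ≤ -c := by
      exact_mod_cast (EReal.coe_ennreal_nonneg _).trans hlt.le
    have hev := eventually_le_rescaled_of_isOpen (s := -c) h0 ht hv hK hm hg hG (by
      rw [← EReal.coe_ennreal_lt_coe_ennreal_iff, EReal.coe_ennreal_ofReal, max_eq_left hc0]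
      exact hlt)
    filter_upwards [hev] with n hn
    simpa using le_inv_mul_log (hpos n) hn

end LDP

end GaussianLDP

/-! ### Transfer to random variables -/

theorem theorem1p1 {E : Type*} [NormedAddCommGroup E] [NormedSpace ℝ E] [CompleteSpace E]
    [TopologicalSpace.SeparableSpace E] [MeasurableSpace E] [BorelSpace E]
    {Ω : ℕ → Type*} [∀ n, MeasurableSpace (Ω n)]
    (P : (n : ℕ) → Measure (Ω n)) [∀ n, IsProbabilityMeasure (P n)]
    {Ω' : Type*} [MeasurableSpace Ω'] (P' : Measure Ω') [IsProbabilityMeasure P']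
    (X : (n : ℕ) → Ω n → E) (Xlim : Ω' → E)
    (hgauss : ∀ n, HasGaussianLaw (X n) (P n))
    (hconv : TendstoInDistribution X atTop Xlim P P') :
    HasGaussianLaw Xlim P' ∧
    ∀ g : ℕ → ℝ, (∀ n, 0 < g n) → Tendsto g atTop atTop →
      GaussianLDP.SatisfiesLDP
        (fun n ↦ (P n).map (fun ω ↦ (g n) ^ (-(1 / 2) : ℝ) • X n ω)) g
        (fun x ↦ GaussianLDP.rkhsNorm
          (P'.map (fun ω ↦ Xlim ω - ∫ ω', Xlim ω' ∂P')) x ^ 2 / 2) := by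
  have : SecondCountableTopology E := UniformSpace.secondCountable_of_separable E
  have hX := hconv.forall_aemeasurable
  have hXlim := hconv.aemeasurable_limit
  have hlim := hconv.tendsto
  set μ : ℕ → ProbabilityMeasure E :=
    fun n ↦ ⟨(P n).map (X n), Measure.isProbabilityMeasure_map (hX n)⟩
  set μ' : ProbabilityMeasure E := ⟨P'.map Xlim, Measure.isProbabilityMeasure_map hXlim⟩
  have hG : ∀ n, IsGaussian (μ n : Measure E) := fun n ↦ (hgauss n).isGaussian_map
  have hG' : IsGaussian (μ' : Measure E) := GaussianLDP.isGaussian_of_tendsto hlim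
  refine ⟨⟨hG'⟩, fun g hpos hg ↦ ?_⟩
  obtain ⟨K, hK, -, hm⟩ := GaussianLDP.exists_isCompact_forall_integral_mem hlim
  have hLDP := GaussianLDP.satisfiesLDP_rescaled (ν' := GaussianLDP.centered (μ' : Measure E))
    (fun n ↦ GaussianLDP.integral_id_centered (μ n : Measure E))
    (GaussianLDP.convexTight_centered hlim)
    (fun L ↦ by
      simp_rw [GaussianLDP.sq_norm_toLp_centered]
      exact GaussianLDP.tendsto_variance hlim L) hK hm hpos hg
  have h1 : P'.map (fun ω ↦ Xlim ω - ∫ ω', Xlim ω' ∂P')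
      = GaussianLDP.centered (μ' : Measure E) := by
    change _ = (P'.map Xlim).map (fun x ↦ x - ∫ y, y ∂(P'.map Xlim))
    rw [AEMeasurable.map_map_of_aemeasurable (by fun_prop) hXlim,
      integral_map hXlim (by fun_prop)]
    rfl
  have h2 : ∀ n, (P n).map (fun ω ↦ (g n) ^ (-(1 / 2) : ℝ) • X n ω)
      = GaussianLDP.rescaled (GaussianLDP.centered (μ n : Measure E))
        (∫ x, x ∂(μ n : Measure E)) (√(g n))⁻¹ := fun n ↦ by
    rw [GaussianLDP.rescaled, GaussianLDP.centered, Measure.map_map (by fun_prop) (by fun_prop)]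
    change _ = ((P n).map (X n)).map _
    rw [AEMeasurable.map_map_of_aemeasurable (by fun_prop) (hX n)]
    congr 1
    ext ω
    simp [Real.rpow_neg (hpos n).le, Real.sqrt_eq_rpow, -smul_add]
  simp_rw [h1, h2]
  exact hLDP
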